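/- Let $d\ge 2$, $q=e^{2\pi i/d}$, and let each qudit be $\mathbb{C}\mathbb{Z}_d$ with basis $|i\rangle$, operators $X^l|i\rangle=|i+l\rangle$, $Z^m|i\rangle=q^{mi}|i\rangle$, and Fourier basis $|\delta_j\rangle\propto\sum_k q^{-jk}|k\rangle$. A *patch* of size $(m,n)$, $m\ge 0$, $n\ge 1$, is a rectangular piece of square lattice with $m$ rows (numbered from the top) and $n$ columns of vertices, smooth boundaries on the left and right and rough boundaries at the top and bottom: it has $m(n-1)$ horizontal edges (pointing right) and $(m+1)n$ vertical edges (pointing up), those in the top and bottom row having a free end. There is one qudit on each edge. For a vertex $v$ let $A(v)=\frac1d\sum_l |l\rangle\triangleright_v$, where $|l\rangle\triangleright_v$ applies $X^l$ to each edge leaving $v$ and $X^{-l}$ to each edge entering $v$. For a face $p$ let $B(p)$ be the projector on the span of those $|x\rangle$ for which $\sum_e\pm x_e=0$, the sum running over the (three or four) edges of $p$, with sign $+$ for edges along and $-$ for edges against the clockwise direction. The logical space $\mathcal H_{vac}$ consists of the states fixed by all $A(v)$ and $B(p)$. Put $|0\rangle_L=\prod_vA(v)\bigotimes_E|0\rangle$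 and $|\delta_0\rangle_L=d^{-mn}\prod_pB(p)\bigotimes_E\sum_i|i\rangle$. Let $|i\rangle_L$ be the result of applying $X^i$ to all vertical edges of one row to $|0\rangle_L$, and $|\delta_i\rangle_L$ the result of applying $Z^{-i}$ to all vertical edges of one column to $|\delta_0\rangle_L$. (A $Z$-string from top to bottom runs against the arrows.) **Logical bases.** On every patch, $|i\rangle_L$ and $|\delta_i\rangle_L$ do not depend on the chosen row or column, each of the families $(|i\rangle_L)_{i\in\mathbb{Z}_d}$ and $(|\delta_i\rangle_L)_{i\in\mathbb{Z}_d}$ is a basis of $\mathcal H_{vac}$, and $|\delta_i\rangle_L=\sum_jq^{-ij}|j\rangle_L$. **Smooth split.** Take a patch of size $(m,n_1+n_2)$ with $n_1,n_2\ge1$, and measure out the $m$ horizontal edges between columns $n_1$ and $n_1+1$ in the (normalised) basis $\{|\delta_i\rangle\}$. The remaining edges form two disjoint patches of sizes $(m,n_1)$ and $(m,n_2)$. There is a linear map $\Delta_s:\mathcal H_{vac}\to(\mathcal H_{vac})_1\otimes(\mathcal H_{vac})_2$ with $$\Delta_s|i\rangle_L=|i\rangle_L\otimes|i\rangle_L\qquad(i\in\mathbb{Z}_d),$$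 such that for every outcome $s\in\mathbb{Z}_d^m$ and every $\psi\in\mathcal H_{vac}$ the (unnormalised) state after the measurement is $d^{-m/2}\,C_s\,\Delta_s\psi$. Here $C_s$ is the Pauli frame of the outcome, with $C_0=1$: the product over the measured edges $r$ of $Z^{s_r}$ on the vertical edges of column $n_1$ of the left patch from the top boundary down to vertex row $r$, and $Z^{-s_r}$ on the same edges of the first column of the right patch. In particular $\Delta_s$ and the scalar do not depend on the outcome. **Rough split.** Take a patch of size $(m_1+m_2+1,n)$ with $m_1,m_2\ge0$, $n\ge1$, and measure out the $n-1$ horizontal edges of vertex row $m_1+1$ in the basis $\{|i\rangle\}$. The remaining edges form two disjoint patches of sizes $(m_1,n)$ (upper) and $(m_2,n)$ (lower), the vertical edges above and below the measured row being their new rough boundaries. There is a linear map $\Delta_r:\mathcal H_{vac}\to(\mathcal H_{vac})_1\otimes(\mathcal H_{vac})_2$ with $$\Delta_r|\delta_i\rangle_L=|\delta_i\rangle_L\otimes|\delta_i\rangle_L,\qquad\text{equivalently}\qquad \Delta_r|i\rangle_L=\sum_{h\in\mathbb{Z}_d}|h\rangle_L\otimes|i-h\rangle_L\qquad(i\in\mathbb{Z}_d),$$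 such that for every outcome $t\in\mathbb{Z}_d^{n-1}$ and every $\psi\in\mathcal H_{vac}$ the (unnormalised) state after the measurement is $d^{-n}\,C'_t\,\Delta_r\psi$. Here $C'_t$ is the Pauli frame of the outcome, with $C'_0=1$: the product over the measured edges $c$ of $X^{t_c}$ on the vertical edges of the last row of the upper patch in columns $1,\dots,c$, and $X^{-t_c}$ on the same edges of the first row of the lower patch. -/

import Mathlib

open scoped TensorProduct ComplexConjugate

noncomputable section

namespace QuditSurface

/-- The state space `⨂_{e ∈ E} ℂ(ℤ/d)` of one qudit per edge `e ∈ E`, in coordinates: `ψ x` is the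
amplitude of the product basis vector `⨂_e |x e⟩`. -/
abbrev Qudits (d : ℕ) (E : Type) : Type := (E → ZMod d) → ℂ

/-! ### Operators on a finite family of qudits -/

section Operators

variable {d : ℕ} [NeZero d] {E : Type} [Fintype E]

/-- `q ^ a` for `a ∈ ℤ/d`, where `q = exp (2 π i / d)`. -/
def qpow (a : ZMod d) : ℂ := ZMod.stdAddChar a

/-- `⨂_e X^{w e}`, where `X^l |i⟩ = |i + l⟩`. -/
def opX (w : E → ZMod d) : Module.End ℂ (Qudits d E) where
  toFun ψ x := ψ (x - w)
  map_add' _ _ := rfl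
  map_smul' _ _ := rfl

/-- `⨂_e Z^{w e}`, where `Z^m |i⟩ = q^{m i} |i⟩`. -/
def opZ (w : E → ZMod d) : Module.End ℂ (Qudits d E) where
  toFun ψ x := qpow (∑ e, w e * x e) * ψ x
  map_add' _ _ := by ext; simp [mul_add]
  map_smul' _ _ := by ext; simp [mul_left_comm]

/-- The diagonal projector `|x⟩ ↦ δ_j(∑_e w e * x e) |x⟩`. -/
def opDelta (w : E → ZMod d) (j : ZMod d) : Module.End ℂ (Qudits d E) where
  toFun ψ x := if ∑ e, w e * x e = j then ψ x else 0
  map_add' _ _ := by ext; simp only [Pi.add_apply]; split_ifs <;> simp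
  map_smul' _ _ := by ext; simp

set_option linter.unusedSectionVars false in
theorem opX_commute (w w' : E → ZMod d) : Commute (opX w) (opX w') := by
  refine LinearMap.ext fun ψ => funext fun x => ?_
  change ψ (x - w - w') = ψ (x - w' - w)
  rw [sub_right_comm]

set_option linter.unusedSectionVars false in
theorem opDelta_commute (w w' : E → ZMod d) (j j' : ZMod d) :
    Commute (opDelta w j) (opDelta w' j') := by
  refine LinearMap.ext fun ψ => funext fun x => ?_
  change (if _ then (if _ then _ else _) else _) = (if _ then (if _ then _ else _) else _)
  split_ifs <;> rfl

/-- The computational basis vector `|j⟩` of one qudit. -/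
def ketZ (j : ZMod d) : ZMod d → ℂ := Pi.single j 1

/-- The vector `|δ_j⟩` of one qudit, normalised to length one: `d^{-1/2} ∑_k q^{-jk} |k⟩`. -/
def ketDelta (j : ZMod d) : ZMod d → ℂ := fun k => (√(d : ℝ) : ℂ)⁻¹ * qpow (-(j * k))

/-- Measuring out the qudits `M`, when the edges `E` are the disjoint union of `M` and `F`: the
(unnormalised) state of the qudits `F` after a projective measurement of every qudit `e ∈ M` has
returned the unit vector `ket e`, that is `(⨂_{e ∈ M} ⟨ket e|) ⊗ id_F` applied to the state. -/
def measureOut {M F : Type} [Fintype M] [DecidableEq M] (φ : M ⊕ F ≃ E) (ket : M → ZMod d → ℂ) :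
    Qudits d E →ₗ[ℂ] Qudits d F where
  toFun ψ y := ∑ x : M → ZMod d, (∏ e, conj (ket e (x e))) * ψ (Sum.elim x y ∘ φ.symm)
  map_add' _ _ := by ext; simp [mul_add, Finset.sum_add_distrib]
  map_smul' _ _ := by ext; simp [Finset.mul_sum, mul_left_comm]

/-- The canonical map `⨂_{F} ⊗ ⨂_{G} → ⨂_{F ⊔ G}`, `|x⟩ ⊗ |y⟩ ↦ |x, y⟩`. -/
def glue (d : ℕ) (F G : Type) : Qudits d F ⊗[ℂ] Qudits d G →ₗ[ℂ] Qudits d (F ⊕ G) :=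
  TensorProduct.lift
    (LinearMap.mk₂ ℂ (fun ψ φ x => ψ (x ∘ Sum.inl) * φ (x ∘ Sum.inr))
      (fun _ _ _ => by ext; simp [add_mul]) (fun _ _ _ => by ext; simp [mul_assoc])
      (fun _ _ _ => by ext; simp [mul_add]) (fun _ _ _ => by ext; simp [mul_left_comm]))

end Operators

/-! ### Patches

The patch with `m` rows and `k + 1` columns of vertices. Rows are numbered from top to bottom,
columns from left to right. Horizontal arrows point right, vertical arrows point up. The top and
bottom boundaries are rough (vertical edges with a free end), left and right are smooth. -/

/-- Edges. `vert r c` ends at the vertex `(r - 1, c)` above it (if `0 < r`) and starts at the vertex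
`(r, c)` below it (if `r < m`); `horiz r c` goes from the vertex `(r, c)` to `(r, c + 1)`. -/
abbrev Edge (m k : ℕ) : Type := (Fin (m + 1) × Fin (k + 1)) ⊕ (Fin m × Fin k)

abbrev vert {m k : ℕ} (r : Fin (m + 1)) (c : Fin (k + 1)) : Edge m k := Sum.inl (r, c)

abbrev horiz {m k : ℕ} (r : Fin m) (c : Fin k) : Edge m k := Sum.inr (r, c)

/-- Vertices: three edges in the first and last column, four otherwise (if `0 < k`). -/
abbrev Vertex (m k : ℕ) : Type := Fin m × Fin (k + 1)

/-- Faces. The face `(r, c)` lies between `vert r c` and `vert r (c + 1)`; in the top and bottom row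
it has three edges, otherwise four (if `0 < m`). -/
abbrev Face (m k : ℕ) : Type := Fin (m + 1) × Fin k

section Patch

variable (d : ℕ) [NeZero d] (m k : ℕ)

/-- The edges at a vertex, `+1` for arrows that leave it and `-1` for arrows that enter it. -/
def star {m k : ℕ} (v : Vertex m k) : Edge m k → ZMod d
  | Sum.inl (r, c) => if c = v.2 then
      (if r = v.1.castSucc then 1 else 0) - (if r = v.1.succ then 1 else 0) else 0
  | Sum.inr (r, c) => if r = v.1 then
      (if c.castSucc = v.2 then 1 else 0) - (if c.succ = v.2 then 1 else 0) else 0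

/-- The edges around a face, `+1` for arrows along the clockwise direction (left and top edge) and
`-1` for arrows against it (right and bottom edge). -/
def boundary {m k : ℕ} (p : Face m k) : Edge m k → ZMod d
  | Sum.inl (r, c) => if r = p.1 then
      (if c = p.2.castSucc then 1 else 0) - (if c = p.2.succ then 1 else 0) else 0
  | Sum.inr (r, c) => if c = p.2 then
      (if r.succ = p.1 then 1 else 0) - (if r.castSucc = p.1 then 1 else 0) else 0

/-- `A(v) = (1/d) ∑_l |l⟩ ▷_v`. -/
def opA {m k : ℕ} (v : Vertex m k) : Module.End ℂ (Qudits d (Edge m k)) :=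
  (d : ℂ)⁻¹ • ∑ l : ZMod d, opX (l • star d v)

/-- `B(p) = |δ_0⟩ ▷_p`. -/
def opB {m k : ℕ} (p : Face m k) : Module.End ℂ (Qudits d (Edge m k)) :=
  opDelta (boundary d p) 0

theorem opA_commute (v v' : Vertex m k) : Commute (opA d v) (opA d v') := by
  unfold opA
  refine Commute.smul_left (Commute.smul_right ?_ _) _
  exact Commute.sum_left _ _ _ fun _ _ => Commute.sum_right _ _ _ fun _ _ => opX_commute _ _

theorem opB_commute (p p' : Face m k) : Commute (opB d p) (opB d p') := opDelta_commute _ _ _ _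

/-- The vacuum space (logical space) of the patch. -/
def vacuum : Submodule ℂ (Qudits d (Edge m k)) :=
  (⨅ v : Vertex m k, LinearMap.eqLocus (opA d v) LinearMap.id) ⊓
    (⨅ p : Face m k, LinearMap.eqLocus (opB d p) LinearMap.id)

/-- `|0⟩_L = ∏_v A(v) ⨂_E |0⟩`. -/
def ketZero : Qudits d (Edge m k) :=
  (Finset.univ.noncommProd (fun v : Vertex m k => opA d v) fun v _ v' _ _ => opA_commute d m k v v')
    (Pi.single 0 1)

/-- `|δ_0⟩_L = ∏_p B(p) ⨂_E ∑_i |i⟩`, divided by `d ^ (number of vertices)`. -/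
def ketDeltaZero : Qudits d (Edge m k) :=
  ((d : ℂ) ^ (m * (k + 1)))⁻¹ •
    (Finset.univ.noncommProd (fun p : Face m k => opB d p)
      fun p _ p' _ _ => opB_commute d m k p p') (fun _ => 1)

/-- The `X`-type string operator `X^i` along the string from the left to the right boundary that
crosses the vertical edges of row `r`. -/
def stringX {m k : ℕ} (r : Fin (m + 1)) (i : ZMod d) : Module.End ℂ (Qudits d (Edge m k)) :=
  opX (Sum.elim (fun e => if e.1 = r then i else 0) fun _ => 0)

/-- The `Z`-type string operator `F^{δ_j}` along the string that runs down column `c`, from the top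
to the bottom boundary; it runs against the arrows, which therefore enter with a minus sign. -/
def stringZ {m k : ℕ} (c : Fin (k + 1)) (j : ZMod d) : Module.End ℂ (Qudits d (Edge m k)) :=
  opDelta (Sum.elim (fun e => if e.2 = c then -1 else 0) fun _ => 0) j

/-- `|i⟩_L`, by means of the `X`-string of row `r`. -/
def ketL {m k : ℕ} (r : Fin (m + 1)) (i : ZMod d) : Qudits d (Edge m k) :=
  stringX d r i (ketZero d m k)

/-- `|δ_i⟩_L = ∑_j q^{ij} F^{δ_j} |δ_0⟩_L`, by means of the `Z`-strings of column `c`. -/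
def ketDeltaL {m k : ℕ} (c : Fin (k + 1)) (i : ZMod d) : Qudits d (Edge m k) :=
  ∑ j : ZMod d, qpow (i * j) • stringZ d c j (ketDeltaZero d m k)

end Patch

/-! ### Splits -/

/-- Cutting the patch with `(k₁ + 1) + (k₂ + 1)` columns between two columns: the measured edges are
the `m` horizontal edges between the columns `k₁` and `k₁ + 1`; all other edges belong to the left
patch, with `k₁ + 1` columns, or to the right patch, with `k₂ + 1` columns. -/
def smoothCut (m k₁ k₂ : ℕ) :
    Fin m ⊕ (Edge m k₁ ⊕ Edge m k₂) ≃ Edge m (k₁ + k₂ + 1) where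
  toFun
    | Sum.inl r => horiz r ⟨k₁, by omega⟩
    | Sum.inr (Sum.inl (Sum.inl (r, c))) => vert r ⟨c, by omega⟩
    | Sum.inr (Sum.inl (Sum.inr (r, c))) => horiz r ⟨c, by omega⟩
    | Sum.inr (Sum.inr (Sum.inl (r, c))) => vert r ⟨k₁ + 1 + c, by omega⟩
    | Sum.inr (Sum.inr (Sum.inr (r, c))) => horiz r ⟨k₁ + 1 + c, by omega⟩
  invFun
    | Sum.inl (r, c) =>
      if h : c.1 < k₁ + 1 then Sum.inr (Sum.inl (vert r ⟨c, h⟩))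
      else Sum.inr (Sum.inr (vert r ⟨c - (k₁ + 1), by omega⟩))
    | Sum.inr (r, c) =>
      if h : c.1 < k₁ then Sum.inr (Sum.inl (horiz r ⟨c, h⟩))
      else if h' : c.1 = k₁ then Sum.inl r
      else Sum.inr (Sum.inr (horiz r ⟨c - (k₁ + 1), by omega⟩))
  left_inv := by
    rintro (r | (⟨r, c⟩ | ⟨r, c⟩) | (⟨r, c⟩ | ⟨r, c⟩)) <;> dsimp only <;> split_ifs <;>
      first | omega | simp
  right_inv := by
    rintro (⟨r, c⟩ | ⟨r, c⟩) <;> dsimp only <;> split_ifs <;> simp [Fin.ext_iff] <;> omega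

/-- Cutting the patch with `m₁ + m₂ + 1` rows of vertices along the vertex row `m₁`: the measured
edges are the `k` horizontal edges of this row; all other edges belong to the upper patch, with `m₁`
rows of vertices, or to the lower patch, with `m₂` rows of vertices. The vertical edges above and
below the row become rough boundaries. -/
def roughCut (m₁ m₂ k : ℕ) :
    Fin k ⊕ (Edge m₁ k ⊕ Edge m₂ k) ≃ Edge (m₁ + m₂ + 1) k where
  toFun
    | Sum.inl c => horiz ⟨m₁, by omega⟩ c
    | Sum.inr (Sum.inl (Sum.inl (r, c))) => vert ⟨r, by omega⟩ c
    | Sum.inr (Sum.inl (Sum.inr (r, c))) => horiz ⟨r, by omega⟩ c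
    | Sum.inr (Sum.inr (Sum.inl (r, c))) => vert ⟨m₁ + 1 + r, by omega⟩ c
    | Sum.inr (Sum.inr (Sum.inr (r, c))) => horiz ⟨m₁ + 1 + r, by omega⟩ c
  invFun
    | Sum.inl (r, c) =>
      if h : r.1 < m₁ + 1 then Sum.inr (Sum.inl (vert ⟨r, h⟩ c))
      else Sum.inr (Sum.inr (vert ⟨r - (m₁ + 1), by omega⟩ c))
    | Sum.inr (r, c) =>
      if h : r.1 < m₁ then Sum.inr (Sum.inl (horiz ⟨r, h⟩ c))
      else if h' : r.1 = m₁ then Sum.inl c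
      else Sum.inr (Sum.inr (horiz ⟨r - (m₁ + 1), by omega⟩ c))
  left_inv := by
    rintro (c | (⟨r, c⟩ | ⟨r, c⟩) | (⟨r, c⟩ | ⟨r, c⟩)) <;> dsimp only <;> split_ifs <;>
      first | omega | simp
  right_inv := by
    rintro (⟨r, c⟩ | ⟨r, c⟩) <;> dsimp only <;> split_ifs <;> simp [Fin.ext_iff] <;> omega

section Split

variable (d : ℕ) [NeZero d] {m m₁ m₂ k k₁ k₂ : ℕ}

/-- The smooth split with outcome `|δ_{s r}⟩` on the measured edge in row `r`. -/
def smoothSplit (s : Fin m → ZMod d) :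
    Qudits d (Edge m (k₁ + k₂ + 1)) →ₗ[ℂ] Qudits d (Edge m k₁ ⊕ Edge m k₂) :=
  measureOut (smoothCut m k₁ k₂) fun r => ketDelta (s r)

/-- The rough split with outcome `|t c⟩` on the measured edge in column `c`. -/
def roughSplit (t : Fin k → ZMod d) :
    Qudits d (Edge (m₁ + m₂ + 1) k) →ₗ[ℂ] Qudits d (Edge m₁ k ⊕ Edge m₂ k) :=
  measureOut (roughCut m₁ m₂ k) fun c => ketZ (t c)

/-- The Pauli frame of a smooth split with outcome `s`: for each row `r'`, the operator `Z^{s r'}` on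
the vertical edges of the last column of the left patch from the top boundary down to the vertex
`r'`, and `Z^{-s r'}` on the same edges of the first column of the right patch. -/
def smoothFrame (s : Fin m → ZMod d) : Module.End ℂ (Qudits d (Edge m k₁ ⊕ Edge m k₂)) :=
  opZ (Sum.elim
    (Sum.elim (fun e => if e.2 = Fin.last k₁ then ∑ r' : Fin m with e.1.1 ≤ r'.1, s r' else 0)
      fun _ => 0)
    (Sum.elim (fun e => if e.2 = 0 then -∑ r' : Fin m with e.1.1 ≤ r'.1, s r' else 0)
      fun _ => 0))

/-- The Pauli frame of a rough split with outcome `t`: for each column `c'`, the operator `X^{t c'}`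
on the vertical edges of the last row of the upper patch from the left boundary up to the measured
edge `c'`, and `X^{-t c'}` on the same edges of the first row of the lower patch. -/
def roughFrame (t : Fin k → ZMod d) : Module.End ℂ (Qudits d (Edge m₁ k ⊕ Edge m₂ k)) :=
  opX (Sum.elim
    (Sum.elim (fun e => if e.1 = Fin.last m₁ then ∑ c' : Fin k with e.2.1 ≤ c'.1, t c' else 0)
      fun _ => 0)
    (Sum.elim (fun e => if e.1 = 0 then -∑ c' : Fin k with e.2.1 ≤ c'.1, t c' else 0)
      fun _ => 0))

/-- The inclusion of the combined logical space of two disjoint patches in the state space of all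
their qudits. -/
def logicalPair (d : ℕ) [NeZero d] (m₁ k₁ m₂ k₂ : ℕ) :
    vacuum d m₁ k₁ ⊗[ℂ] vacuum d m₂ k₂ →ₗ[ℂ] Qudits d (Edge m₁ k₁ ⊕ Edge m₂ k₂) :=
  glue d (Edge m₁ k₁) (Edge m₂ k₂) ∘ₗ
    TensorProduct.map (vacuum d m₁ k₁).subtype (vacuum d m₂ k₂).subtype

end Split

end QuditSurface

end

open QuditSurface

/-!
Everything is done in the computational basis, where a basis vector is a configuration `x : Edge m k
→ ZMod d`. The face operators select the flat configurations, and the vertex operators average over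
gauge transformations. The idea is that a flat configuration is, up to gauge, nothing but its
holonomy `hol` along a column.

The discrete fundamental theorem of calculus `eq_rowBelow_sub_rowAbove_iff`, applied along columns,
integrates the flatness condition (`isFlat_iff`): the holonomies of all columns agree, and the
vertical edges determine the horizontal ones. It also shows that gauge transformations act freely,
with the flat configurations of holonomy zero as the orbit of `0` (`eq_gauge_iff`). Hence the
logical space is the space of functions of the holonomy (`holEquiv`): the function `f` stands for
the state `holState m k f`, with amplitude `d ^ (-number of vertices) * f (hol 0 x)` at flat `x` and
`0` elsewhere. In this picture `|i⟩_L` is the indicator function of `i` (`ketL_eq`), and `|δ_i⟩_L`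
is the character `h ↦ q ^ (-i h)` (`ketDeltaL_eq`), so that the second family is the discrete
Fourier transform of the first. Neither description refers to the row or column of the string.

For a smooth cut (`isFlat_smoothCut_iff`), a configuration is flat if and only if both sides are
flat with the same holonomy, and the cut edges have the values forced by the two sides. Thus exactly
one term of the measurement sum survives; its phase is the Pauli frame, and what remains is the
diagonal coproduct on functions of the holonomy. For a rough cut (`isFlat_roughCut_iff`,
`hol_roughCut`), the Pauli frame restores the flatness of the faces along the cut, and the holonomy
of the whole is the sum of the holonomies of the two parts, which gives the convolution coproduct.
The Fourier transform makes the latter diagonal. A smooth cut removes no vertices, and its scalar is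
the normalisation of the `m` measured vectors `|δ_{s r}⟩`; a rough cut removes one row of `k + 1`
vertices, which gives the scalar `d ^ (-(k + 1))`.
-/

namespace QuditSurface

/-! ### Flat configurations and gauge transformations -/

section Column

variable {G : Type*} [AddCommGroup G] {m : ℕ}

/-- The value of `h` at the vertex row just above the face row `r`, and `0` at the top boundary. -/
def rowAbove (h : Fin m → G) (r : Fin (m + 1)) : G :=
  if hr : r.1 = 0 then 0 else h ⟨r.1 - 1, by omega⟩

/-- The value of `h` at the vertex row just below the face row `r`, and `0` at the bottom
boundary. -/
def rowBelow (h : Fin m → G) (r : Fin (m + 1)) : G :=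
  if hr : r.1 < m then h ⟨r.1, hr⟩ else 0

theorem sum_ite_succ (h : Fin m → G) (r : Fin (m + 1)) :
    ∑ r' : Fin m, (if r'.succ = r then h r' else 0) = rowAbove h r := by
  refine Fin.cases ?_ (fun j => ?_) r
  · simp [rowAbove, Fin.succ_ne_zero]
  · simp [rowAbove]

theorem sum_ite_castSucc (h : Fin m → G) (r : Fin (m + 1)) :
    ∑ r' : Fin m, (if r'.castSucc = r then h r' else 0) = rowBelow h r := by
  refine Fin.lastCases ?_ (fun j => ?_) r
  · simp [rowBelow, Fin.castSucc_ne_last]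
  · simp [rowBelow]

theorem sum_rowBelow_sub_rowAbove_le (h : Fin m → G) (j : ℕ) (hj : j < m) :
    ∑ r' : Fin (m + 1) with r'.1 ≤ j, (rowBelow h r' - rowAbove h r') = h ⟨j, hj⟩ := by
  induction j with
  | zero =>
    have : (Finset.univ.filter fun r' : Fin (m + 1) => r'.1 ≤ 0) = {0} := by
      ext r
      simp only [Finset.mem_filter, Finset.mem_univ, true_and, Finset.mem_singleton, Fin.ext_iff,
        Fin.val_zero, Nat.le_zero]
    rw [this, Finset.sum_singleton]
    simp [rowBelow, rowAbove, hj]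
  | succ j ih =>
    have : (Finset.univ.filter fun r' : Fin (m + 1) => r'.1 ≤ j + 1) =
        insert ⟨j + 1, by omega⟩ (Finset.univ.filter fun r' : Fin (m + 1) => r'.1 ≤ j) := by
      ext r; simp [Fin.ext_iff]; omega
    rw [this, Finset.sum_insert (by simp), ih (by omega)]
    simp [rowBelow, rowAbove, hj]

/-- The discrete fundamental theorem of calculus: `a` is the difference sequence of `h`, extended
by zero at both ends, if and only if `h` is the sequence of partial sums of `a` and the total sum
of `a` vanishes. -/
theorem eq_rowBelow_sub_rowAbove_iff (a : Fin (m + 1) → G) (h : Fin m → G) :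
    (∀ r, a r = rowBelow h r - rowAbove h r) ↔
      (∀ r : Fin m, ∑ r' : Fin (m + 1) with r'.1 ≤ r.1, a r' = h r) ∧ ∑ r, a r = 0 := by
  constructor
  · intro H
    obtain rfl : a = fun r => rowBelow h r - rowAbove h r := funext H
    refine ⟨fun r => sum_rowBelow_sub_rowAbove_le h r.1 r.2, ?_⟩
    rw [Finset.sum_sub_distrib, Fin.sum_univ_castSucc, Fin.sum_univ_succ]
    simp [rowBelow, rowAbove]
  · rintro ⟨H, H0⟩ r
    obtain ⟨r, hr⟩ := r
    have below : rowBelow h ⟨r, hr⟩ = ∑ r' : Fin (m + 1) with r'.1 ≤ r, a r' := by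
      unfold rowBelow
      split_ifs with hm
      · exact (H ⟨r, hm⟩).symm
      · rw [Finset.filter_true_of_mem (fun r' _ => by have := r'.2; simp at hm; omega), H0]
    have above : rowAbove h ⟨r, hr⟩ = ∑ r' : Fin (m + 1) with r'.1 < r, a r' := by
      unfold rowAbove
      split_ifs with hm
      · simp only at hm
        subst hm
        simp
      · simp only at hm
        rw [← H]
        refine Finset.sum_congr (Finset.filter_congr fun r' _ => ?_) fun _ _ => rfl
        simp only
        omega
    have : (Finset.univ.filter fun r' : Fin (m + 1) => r'.1 ≤ r) =
        insert ⟨r, hr⟩ (Finset.univ.filter fun r' : Fin (m + 1) => r'.1 < r) := by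
      ext r; simp [Fin.ext_iff]; omega
    rw [below, above, this, Finset.sum_insert (by simp), add_sub_cancel_right]

end Column

section Configurations

variable {d m k : ℕ}

/-- The holonomy of a configuration along the column `c`, from the bottom to the top. -/
def hol (c : Fin (k + 1)) (x : Edge m k → ZMod d) : ZMod d := ∑ r, x (vert r c)

/-- The holonomy along the column `c`, from the vertex row `r` up to the top boundary. -/
def colSum (x : Edge m k → ZMod d) (r : Fin m) (c : Fin (k + 1)) : ZMod d :=
  ∑ r' : Fin (m + 1) with r'.1 ≤ r.1, x (vert r' c)

/-- A configuration is flat if its holonomy around every face vanishes. -/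
def IsFlat (x : Edge m k → ZMod d) : Prop := ∀ p : Face m k, ∑ e, boundary d p e * x e = 0

instance (x : Edge m k → ZMod d) : Decidable (IsFlat x) := by unfold IsFlat; infer_instance

theorem hol_sub (c : Fin (k + 1)) (x y : Edge m k → ZMod d) :
    hol c (x - y) = hol c x - hol c y := by
  simp [hol]

theorem IsFlat.sub {x y : Edge m k → ZMod d} (hx : IsFlat x) (hy : IsFlat y) :
    IsFlat (x - y) := fun p => by
  simp [mul_sub, Finset.sum_sub_distrib, hx p, hy p]

theorem isFlat_sub_iff {x y : Edge m k → ZMod d} (hy : IsFlat y) :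
    IsFlat (x - y) ↔ IsFlat x := by
  refine ⟨fun h p => ?_, fun h => h.sub hy⟩
  simpa [mul_sub, Finset.sum_sub_distrib, hy p] using h p

theorem sum_boundary_mul (p : Face m k) (x : Edge m k → ZMod d) :
    ∑ e, boundary d p e * x e =
      x (vert p.1 p.2.castSucc) - x (vert p.1 p.2.succ) -
        (rowBelow (fun r => x (horiz r p.2)) p.1 - rowAbove (fun r => x (horiz r p.2)) p.1) := by
  rw [← sum_ite_succ, ← sum_ite_castSucc]
  simp [Fintype.sum_sum_type, Fintype.sum_prod_type, boundary, sub_mul, ite_mul,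
    Finset.sum_sub_distrib]
  abel

theorem isFlat_iff_face (x : Edge m k → ZMod d) :
    IsFlat x ↔ ∀ (c : Fin k) (r : Fin (m + 1)), x (vert r c.castSucc) - x (vert r c.succ) =
      rowBelow (fun r => x (horiz r c)) r - rowAbove (fun r => x (horiz r c)) r := by
  simp only [IsFlat, Prod.forall, sum_boundary_mul, sub_eq_zero (b := _ - _)]
  exact forall_comm

/-- Flatness, integrated along the columns of faces: the horizontal edges are determined by the
vertical ones, and the holonomies of neighbouring columns agree. -/
theorem isFlat_iff (x : Edge m k → ZMod d) :
    IsFlat x ↔ ∀ c : Fin k,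
      (∀ r, colSum x r c.castSucc - colSum x r c.succ = x (horiz r c)) ∧
        hol c.castSucc x = hol c.succ x := by
  simp only [isFlat_iff_face, eq_rowBelow_sub_rowAbove_iff, Finset.sum_sub_distrib, sub_eq_zero]
  rfl

theorem IsFlat.hol_eq {x : Edge m k → ZMod d} (hx : IsFlat x) (c : Fin (k + 1)) :
    hol c x = hol 0 x := by
  induction c using Fin.induction with
  | zero => rfl
  | succ c ih => rw [← ih, ((isFlat_iff x).1 hx c).2]

/-- The gauge transformation with parameter `g`, applied to the trivial configuration. -/
def gauge (g : Vertex m k → ZMod d) : Edge m k → ZMod d := ∑ v, g v • star d v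

theorem gauge_vert (g : Vertex m k → ZMod d) (r : Fin (m + 1)) (c : Fin (k + 1)) :
    gauge g (vert r c) = rowBelow (fun r => g (r, c)) r - rowAbove (fun r => g (r, c)) r := by
  rw [← sum_ite_succ, ← sum_ite_castSucc]
  simp [gauge, star, Fintype.sum_prod_type, Finset.sum_apply, mul_sub, Finset.sum_sub_distrib,
    eq_comm (a := r)]

theorem gauge_horiz (g : Vertex m k → ZMod d) (r : Fin m) (c : Fin k) :
    gauge g (horiz r c) = g (r, c.castSucc) - g (r, c.succ) := by
  simp [gauge, star, Fintype.sum_prod_type, Finset.sum_apply, mul_sub, Finset.sum_sub_distrib]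

/-- Gauge transformations act freely, and the orbit of the trivial configuration consists of the
flat configurations with trivial holonomy; the parameter is recovered as the holonomy from a vertex
up to the top boundary. -/
theorem eq_gauge_iff (x : Edge m k → ZMod d) (g : Vertex m k → ZMod d) :
    x = gauge g ↔ (IsFlat x ∧ hol 0 x = 0) ∧ g = fun v => colSum x v.1 v.2 := by
  have key : x = gauge g ↔
      (∀ c, (∀ r, colSum x r c = g (r, c)) ∧ hol c x = 0) ∧
        ∀ r c, x (horiz r c) = g (r, c.castSucc) - g (r, c.succ) := by
    have h1 : ∀ c, ((∀ r, colSum x r c = g (r, c)) ∧ hol c x = 0) ↔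
        ∀ r, x (vert r c) = gauge g (vert r c) := fun c => by
      simp only [gauge_vert]
      exact (eq_rowBelow_sub_rowAbove_iff _ _).symm
    simp only [h1, ← gauge_horiz]
    rw [funext_iff, Sum.forall, Prod.forall, Prod.forall, forall_comm]
  rw [key]
  constructor
  · rintro ⟨h1, h2⟩
    refine ⟨⟨(isFlat_iff x).2 fun c => ⟨fun r => ?_, ?_⟩, (h1 0).2⟩, ?_⟩
    · rw [(h1 _).1, (h1 _).1, h2]
    · rw [(h1 _).2, (h1 _).2]
    · exact funext fun v => ((h1 _).1 _).symm
  · rintro ⟨⟨hx, h0⟩, rfl⟩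
    exact ⟨fun c => ⟨fun _ => rfl, by rw [hx.hol_eq, h0]⟩,
      fun r c => (((isFlat_iff x).1 hx c).1 r).symm⟩

theorem isFlat_gauge (g : Vertex m k → ZMod d) : IsFlat (gauge g) :=
  ((eq_gauge_iff _ g).1 rfl).1.1

theorem hol_gauge (g : Vertex m k → ZMod d) : hol 0 (gauge g) = 0 :=
  ((eq_gauge_iff _ g).1 rfl).1.2

theorem gauge_single (v : Vertex m k) (l : ZMod d) : gauge (Pi.single v l) = l • star d v := by
  rw [gauge, Finset.sum_eq_single v (fun w _ h => by simp [h]) (by simp), Pi.single_eq_same]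

/-- The configuration with the value `i` on the vertical edges of row `r`. -/
def rowConfig (r : Fin (m + 1)) (i : ZMod d) : Edge m k → ZMod d :=
  Sum.elim (fun e => if e.1 = r then i else 0) fun _ => 0

theorem isFlat_rowConfig (r : Fin (m + 1)) (i : ZMod d) :
    IsFlat (rowConfig r i : Edge m k → ZMod d) := by
  rw [isFlat_iff_face]
  simp [rowConfig, rowBelow, rowAbove]

theorem hol_rowConfig (c : Fin (k + 1)) (r : Fin (m + 1)) (i : ZMod d) :
    hol c (rowConfig r i : Edge m k → ZMod d) = i := by
  simp [hol, rowConfig]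

theorem opB_apply (p : Face m k) (ψ : Qudits d (Edge m k)) (x : Edge m k → ZMod d) :
    opB d p ψ x = if ∑ e, boundary d p e * x e = 0 then ψ x else 0 := rfl

theorem noncommProd_opB_apply (s : Finset (Face m k))
    (comm : (s : Set (Face m k)).Pairwise (Function.onFun Commute fun p => opB d p))
    (ψ : Qudits d (Edge m k)) (x : Edge m k → ZMod d) :
    s.noncommProd (fun p => opB d p) comm ψ x =
      if ∀ p ∈ s, ∑ e, boundary d p e * x e = 0 then ψ x else 0 := by
  induction s using Finset.induction_on with
  | empty => simp
  | insert a s ha ih =>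
    rw [Finset.noncommProd_insert_of_notMem _ _ _ comm ha, Module.End.mul_apply, opB_apply, ih]
    simp only [Finset.forall_mem_insert, ite_and]

end Configurations

/-! ### The logical space -/

section Logical

variable {d : ℕ} [NeZero d] {m k : ℕ}

theorem opA_apply (v : Vertex m k) (ψ : Qudits d (Edge m k)) (x : Edge m k → ZMod d) :
    opA d v ψ x = (d : ℂ)⁻¹ * ∑ l : ZMod d, ψ (x - l • star d v) := by
  simp [opA, opX, LinearMap.sum_apply, Finset.sum_apply]

/-- A product of vertex operators averages over the gauge transformations at these vertices. -/
theorem noncommProd_opA_apply (s : Finset (Vertex m k))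
    (comm : (s : Set (Vertex m k)).Pairwise (Function.onFun Commute fun v => opA d v))
    (ψ : Qudits d (Edge m k)) (x : Edge m k → ZMod d) :
    s.noncommProd (fun v => opA d v) comm ψ x =
      ((d : ℂ) ^ (m * (k + 1)))⁻¹ *
        ∑ g : Vertex m k → ZMod d, ψ (x - ∑ v ∈ s, g v • star d v) := by
  induction s using Finset.induction_on generalizing x with
  | empty => simp [NeZero.ne d]
  | insert a s ha ih =>
    rw [Finset.noncommProd_insert_of_notMem _ _ _ comm ha, Module.End.mul_apply, opA_apply]
    simp only [ih, ← Finset.mul_sum, Finset.sum_insert ha]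
    rw [mul_left_comm]
    congr 1
    -- Both sides are averages over `l : ZMod d` and `g`; the shift of `g a` by `l` identifies them.
    have shift (l : ZMod d) :
        ∑ g : Vertex m k → ZMod d, ψ (x - (g a • star d a + ∑ v ∈ s, g v • star d v)) =
        ∑ g : Vertex m k → ZMod d, ψ (x - ((g a + l) • star d a + ∑ v ∈ s, g v • star d v)) := by
      rw [← Equiv.sum_comp (Equiv.addRight (Pi.single a l))]
      refine Finset.sum_congr rfl fun g _ => ?_
      congr 3
      · simp
      · refine Finset.sum_congr rfl fun v hv => ?_
        have : v ≠ a := fun h => ha (h ▸ hv)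
        simp [this]
    have avg : ∑ l : ZMod d, ∑ g : Vertex m k → ZMod d,
        ψ (x - ((g a + l) • star d a + ∑ v ∈ s, g v • star d v)) =
        ∑ l : ZMod d, ∑ g : Vertex m k → ZMod d,
          ψ (x - l • star d a - ∑ v ∈ s, g v • star d v) := by
      rw [Finset.sum_comm, Finset.sum_comm (s := (Finset.univ : Finset (ZMod d)))]
      refine Finset.sum_congr rfl fun g _ => ?_
      rw [← Equiv.sum_comp (Equiv.addLeft (g a))
        fun l => ψ (x - l • star d a - ∑ v ∈ s, g v • star d v)]
      simp [sub_sub]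
    rw [← avg, ← Finset.sum_congr rfl fun l _ => shift l]
    simp [NeZero.ne d]

/-- The state whose amplitude at a flat configuration is `f` of its holonomy, up to the
normalisation `d ^ (-number of vertices)`, and which vanishes at all other configurations. -/
noncomputable def holState (m k : ℕ) (f : ZMod d → ℂ) : Qudits d (Edge m k) := fun x =>
  if IsFlat x then ((d : ℂ) ^ (m * (k + 1)))⁻¹ * f (hol 0 x) else 0

theorem ketZero_eq : ketZero d m k = holState m k (Pi.single 0 1) := by
  funext x
  rw [ketZero]
  refine (noncommProd_opA_apply _ _ _ _).trans ?_
  rw [holState]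
  have (g : Vertex m k → ZMod d) :
      (Pi.single 0 1 : Qudits d (Edge m k)) (x - ∑ v, g v • star d v) =
        if g = (fun v => colSum x v.1 v.2) then if IsFlat x ∧ hol 0 x = 0 then 1 else 0 else 0 := by
    rw [← ite_and, Pi.single_apply]
    refine if_congr ?_ rfl rfl
    rw [sub_eq_zero, and_comm]
    exact eq_gauge_iff x g
  rw [Finset.sum_congr rfl fun g _ => this g, Finset.sum_ite_eq' Finset.univ, if_pos (by simp)]
  by_cases h : IsFlat x <;> simp [h, Pi.single_apply]

theorem ketDeltaZero_eq : ketDeltaZero d m k = holState m k 1 := by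
  funext x
  refine (congrArg (((d : ℂ) ^ (m * (k + 1)))⁻¹ • ·) (noncommProd_opB_apply _ _ _ _)).trans ?_
  rw [holState]
  by_cases h : IsFlat x
  · rw [if_pos h, if_pos fun p _ => h p]
    rfl
  · rw [if_neg h, if_neg fun h' => h fun p => h' p (Finset.mem_univ p), smul_zero]

theorem ketL_eq (r : Fin (m + 1)) (i : ZMod d) :
    ketL d r i = holState m k (Pi.single i 1) := by
  funext x
  change ketZero d m k (x - rowConfig r i) = _
  rw [ketZero_eq]
  simp only [holState, isFlat_sub_iff (isFlat_rowConfig r i), hol_sub, hol_rowConfig,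
    Pi.single_apply, sub_eq_zero]

theorem ketDeltaL_eq (c : Fin (k + 1)) (i : ZMod d) :
    ketDeltaL d c i = holState m k fun h => qpow (-(i * h)) := by
  funext x
  have hc : ∑ e : Edge m k, (Sum.elim (fun e => if e.2 = c then -1 else 0) (fun _ => 0) :
      Edge m k → ZMod d) e * x e = - hol c x := by
    simp [Fintype.sum_sum_type, Fintype.sum_prod_type, hol]
  rw [ketDeltaL, Finset.sum_apply, ketDeltaZero_eq]
  simp only [Pi.smul_apply, stringZ, opDelta, LinearMap.coe_mk, AddHom.coe_mk, hc, smul_eq_mul,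
    mul_ite, mul_zero, Finset.sum_ite_eq, Finset.mem_univ, if_true, holState]
  split_ifs with h
  · rw [h.hol_eq, mul_neg, Pi.one_apply]
    ring
  · rfl

theorem mem_vacuum_iff (ψ : Qudits d (Edge m k)) :
    ψ ∈ vacuum d m k ↔ (∀ v, opA d v ψ = ψ) ∧ ∀ p, opB d p ψ = ψ := by
  simp [vacuum, Submodule.mem_inf, Submodule.mem_iInf, LinearMap.mem_eqLocus]

theorem holState_mem_vacuum (f : ZMod d → ℂ) : holState m k f ∈ vacuum d m k := by
  rw [mem_vacuum_iff]
  refine ⟨fun v => funext fun x => ?_, fun p => funext fun x => ?_⟩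
  · rw [opA_apply]
    simp only [← gauge_single, holState, isFlat_sub_iff (isFlat_gauge _), hol_sub, hol_gauge,
      sub_zero]
    simp [NeZero.ne d]
  · rw [opB_apply]
    by_cases h : IsFlat x
    · rw [if_pos (h p)]
    · simp [holState, h]

theorem vacuum_apply_sub_star {ψ : Qudits d (Edge m k)} (hψ : ψ ∈ vacuum d m k) (v : Vertex m k)
    (l : ZMod d) (x : Edge m k → ZMod d) : ψ (x - l • star d v) = ψ x := by
  have h := ((mem_vacuum_iff ψ).1 hψ).1 v
  rw [← h, opA_apply, opA_apply, ← Equiv.sum_comp (Equiv.addLeft l) fun l => ψ (x - l • star d v)]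
  simp [sub_sub, add_smul]

theorem vacuum_apply_sub_gauge {ψ : Qudits d (Edge m k)} (hψ : ψ ∈ vacuum d m k)
    (g : Vertex m k → ZMod d) (x : Edge m k → ZMod d) : ψ (x - gauge g) = ψ x := by
  unfold gauge
  induction (Finset.univ : Finset (Vertex m k)) using Finset.induction_on with
  | empty => simp
  | insert a s ha ih =>
    rw [Finset.sum_insert ha, add_comm, ← sub_sub, vacuum_apply_sub_star hψ, ih]

theorem vacuum_apply_of_not_isFlat {ψ : Qudits d (Edge m k)} (hψ : ψ ∈ vacuum d m k)
    {x : Edge m k → ZMod d} (hx : ¬ IsFlat x) : ψ x = 0 := by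
  simp only [IsFlat, not_forall] at hx
  obtain ⟨p, hp⟩ := hx
  rw [← ((mem_vacuum_iff ψ).1 hψ).2 p, opB_apply, if_neg hp]

/-- The amplitude of a logical state at a flat configuration depends on the holonomy only. -/
theorem vacuum_apply_of_isFlat {ψ : Qudits d (Edge m k)} (hψ : ψ ∈ vacuum d m k)
    {x : Edge m k → ZMod d} (hx : IsFlat x) : ψ x = ψ (rowConfig 0 (hol 0 x)) := by
  have h := (eq_gauge_iff (x - rowConfig 0 (hol 0 x)) _).2
    ⟨⟨hx.sub (isFlat_rowConfig _ _), by rw [hol_sub, hol_rowConfig, sub_self]⟩, rfl⟩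
  rw [← vacuum_apply_sub_gauge hψ _ x, ← h, sub_sub_cancel]

/-- The logical space is the space of functions of the holonomy. -/
noncomputable def holEquiv (d : ℕ) [NeZero d] (m k : ℕ) : (ZMod d → ℂ) ≃ₗ[ℂ] vacuum d m k where
  toFun f := ⟨holState m k f, holState_mem_vacuum f⟩
  map_add' f g := by
    ext x
    by_cases h : IsFlat x <;> simp [holState, h, mul_add]
  map_smul' a f := by
    ext x
    by_cases h : IsFlat x <;> simp [holState, h, mul_left_comm]
  invFun ψ i := (d : ℂ) ^ (m * (k + 1)) * (ψ : Qudits d (Edge m k)) (rowConfig 0 i)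
  left_inv f := by
    ext i
    simp [holState, isFlat_rowConfig, hol_rowConfig, NeZero.ne d]
  right_inv ψ := by
    ext x
    by_cases h : IsFlat x
    · rw [vacuum_apply_of_isFlat ψ.2 h]
      simp [holState, h, NeZero.ne d]
    · rw [vacuum_apply_of_not_isFlat ψ.2 h]
      simp [holState, h]

/-- The logical basis `|i⟩_L`. -/
noncomputable def logicalBasis (d : ℕ) [NeZero d] (m k : ℕ) :
    Module.Basis (ZMod d) ℂ (vacuum d m k) :=
  (Pi.basisFun ℂ (ZMod d)).map (holEquiv d m k)

/-- The logical basis `|δ_i⟩_L`, the discrete Fourier transform of the basis `|i⟩_L`. -/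
noncomputable def logicalFourierBasis (d : ℕ) [NeZero d] (m k : ℕ) :
    Module.Basis (ZMod d) ℂ (vacuum d m k) :=
  (Pi.basisFun ℂ (ZMod d)).map (ZMod.dft ≪≫ₗ holEquiv d m k)

theorem coe_logicalBasis (i : ZMod d) :
    (logicalBasis d m k i : Qudits d (Edge m k)) = holState m k (Pi.single i 1) := by
  simp [logicalBasis, holEquiv]

theorem dft_single (i : ZMod d) :
    ZMod.dft (Pi.single i (1 : ℂ)) = fun h => qpow (-(i * h)) := by
  ext h
  simp [ZMod.dft_apply, Pi.single_apply, qpow]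

theorem coe_logicalFourierBasis (i : ZMod d) :
    (logicalFourierBasis d m k i : Qudits d (Edge m k)) =
      holState m k fun h => qpow (-(i * h)) := by
  rw [← dft_single]
  simp [logicalFourierBasis, holEquiv]

theorem logicalFourierBasis_eq_sum (i : ZMod d) :
    logicalFourierBasis d m k i = ∑ j : ZMod d, qpow (-(i * j)) • logicalBasis d m k j := by
  have h : (fun h : ZMod d => qpow (-(i * h))) =
      ∑ j : ZMod d, qpow (-(i * j)) • Pi.single j (1 : ℂ) := by
    ext h
    simp [Finset.sum_apply, Pi.single_apply]
  have h' : logicalFourierBasis d m k i = holEquiv d m k fun h => qpow (-(i * h)) := by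
    simp [logicalFourierBasis, dft_single]
  rw [h', h, map_sum]
  simp [logicalBasis]

end Logical

section Splits

variable {d : ℕ} {m m₁ m₂ k k₁ k₂ : ℕ}

/-! ### Configurations and smooth cuts -/

theorem forall_fin_add_one_add_iff {a b : ℕ} (P : Fin (a + b + 1) → Prop) :
    (∀ c, P c) ↔ (∀ c : Fin a, P ⟨c, by omega⟩) ∧ P ⟨a, by omega⟩ ∧
      ∀ c : Fin b, P ⟨a + 1 + c, by omega⟩ := by
  refine ⟨fun h => ⟨fun _ => h _, h _, fun _ => h _⟩, fun ⟨h1, h2, h3⟩ c => ?_⟩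
  rcases lt_trichotomy c.1 a with h | h | h
  · exact h1 ⟨c, h⟩
  · convert h2
  · convert h3 ⟨c - (a + 1), by omega⟩
    simp only
    omega

/-- A configuration is flat if and only if its restrictions to the two sides of a smooth cut are
flat with equal holonomies, and the cut edges carry the values forced by the two sides. -/
theorem isFlat_smoothCut_iff (x : Fin m → ZMod d) (y : Edge m k₁ ⊕ Edge m k₂ → ZMod d) :
    IsFlat (Sum.elim x y ∘ (smoothCut m k₁ k₂).symm) ↔
      (IsFlat (y ∘ Sum.inl) ∧ IsFlat (y ∘ Sum.inr) ∧
        hol (Fin.last k₁) (y ∘ Sum.inl) = hol 0 (y ∘ Sum.inr)) ∧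
        x = fun r => colSum (y ∘ Sum.inl) r (Fin.last k₁) - colSum (y ∘ Sum.inr) r 0 := by
  set z := Sum.elim x y ∘ (smoothCut m k₁ k₂).symm with z_def
  have hz (e) : z (smoothCut m k₁ k₂ e) = Sum.elim x y e := by simp [z_def]
  have vl (r : Fin (m + 1)) (c : Fin (k₁ + 1)) :
      z (vert r ⟨c, by omega⟩) = y (Sum.inl (vert r c)) :=
    hz (Sum.inr (Sum.inl (vert r c)))
  have vr (r : Fin (m + 1)) (c : Fin (k₂ + 1)) :
      z (vert r ⟨k₁ + 1 + c, by omega⟩) = y (Sum.inr (vert r c)) :=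
    hz (Sum.inr (Sum.inr (vert r c)))
  have colSum_l (r : Fin m) (c : Fin (k₁ + 1)) :
      colSum z r ⟨c, by omega⟩ = colSum (y ∘ Sum.inl) r c :=
    Finset.sum_congr rfl fun _ _ => vl _ _
  have colSum_r (r : Fin m) (c : Fin (k₂ + 1)) :
      colSum z r ⟨k₁ + 1 + c, by omega⟩ = colSum (y ∘ Sum.inr) r c :=
    Finset.sum_congr rfl fun _ _ => vr _ _
  have hol_l (c : Fin (k₁ + 1)) : hol ⟨c, by omega⟩ z = hol c (y ∘ Sum.inl) :=
    Finset.sum_congr rfl fun _ _ => vl _ _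
  have hol_r (c : Fin (k₂ + 1)) : hol ⟨k₁ + 1 + c, by omega⟩ z = hol c (y ∘ Sum.inr) :=
    Finset.sum_congr rfl fun _ _ => vr _ _
  rw [isFlat_iff z, forall_fin_add_one_add_iff]
  have left : (∀ c : Fin k₁, (∀ r, colSum z r (⟨c, by omega⟩ : Fin (k₁ + k₂ + 1)).castSucc -
      colSum z r (⟨c, by omega⟩ : Fin (k₁ + k₂ + 1)).succ = z (horiz r ⟨c, by omega⟩)) ∧
      hol (⟨c, by omega⟩ : Fin (k₁ + k₂ + 1)).castSucc z =
        hol (⟨c, by omega⟩ : Fin (k₁ + k₂ + 1)).succ z) ↔ IsFlat (y ∘ Sum.inl) := by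
    rw [isFlat_iff]
    refine forall_congr' fun c => and_congr (forall_congr' fun r => ?_) ?_
    · rw [← colSum_l, ← colSum_l]
      exact Eq.congr_right (hz (Sum.inr (Sum.inl (horiz r c))))
    · rw [← hol_l, ← hol_l]
      rfl
  have right : (∀ c : Fin k₂,
      (∀ r, colSum z r (⟨k₁ + 1 + c, by omega⟩ : Fin (k₁ + k₂ + 1)).castSucc -
      colSum z r (⟨k₁ + 1 + c, by omega⟩ : Fin (k₁ + k₂ + 1)).succ =
        z (horiz r ⟨k₁ + 1 + c, by omega⟩)) ∧
      hol (⟨k₁ + 1 + c, by omega⟩ : Fin (k₁ + k₂ + 1)).castSucc z =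
        hol (⟨k₁ + 1 + c, by omega⟩ : Fin (k₁ + k₂ + 1)).succ z) ↔ IsFlat (y ∘ Sum.inr) := by
    rw [isFlat_iff]
    refine forall_congr' fun c => and_congr (forall_congr' fun r => ?_) ?_
    · rw [← colSum_r, ← colSum_r]
      exact Eq.congr_right (hz (Sum.inr (Sum.inr (horiz r c))))
    · rw [← hol_r, ← hol_r]
      rfl
  have middle : ((∀ r, colSum z r (⟨k₁, by omega⟩ : Fin (k₁ + k₂ + 1)).castSucc -
      colSum z r (⟨k₁, by omega⟩ : Fin (k₁ + k₂ + 1)).succ = z (horiz r ⟨k₁, by omega⟩)) ∧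
      hol (⟨k₁, by omega⟩ : Fin (k₁ + k₂ + 1)).castSucc z =
        hol (⟨k₁, by omega⟩ : Fin (k₁ + k₂ + 1)).succ z) ↔
      (x = fun r => colSum (y ∘ Sum.inl) r (Fin.last k₁) - colSum (y ∘ Sum.inr) r 0) ∧
        hol (Fin.last k₁) (y ∘ Sum.inl) = hol 0 (y ∘ Sum.inr) := by
    rw [funext_iff]
    refine and_congr (forall_congr' fun r => ?_) ?_
    · rw [← colSum_l, ← colSum_r, eq_comm]
      exact Eq.congr_left (hz (Sum.inl r))
    · rw [← hol_l, ← hol_r]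
      rfl
  rw [left, right, middle]
  tauto

/-- The Pauli frame of a smooth split is the phase `q ^ (∑ r, s r * x r)`, where `x r` is the value
on the cut edge in row `r` that flatness forces. -/
theorem sum_smoothFrame_mul (s : Fin m → ZMod d) (y : Edge m k₁ ⊕ Edge m k₂ → ZMod d) :
    ∑ e, (Sum.elim
      (Sum.elim (fun e => if e.2 = Fin.last k₁ then ∑ r' : Fin m with e.1.1 ≤ r'.1, s r' else 0)
        fun _ => 0)
      (Sum.elim (fun e => if e.2 = 0 then -∑ r' : Fin m with e.1.1 ≤ r'.1, s r' else 0)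
        fun _ => 0) : Edge m k₁ ⊕ Edge m k₂ → ZMod d) e * y e =
      ∑ r, s r * (colSum (y ∘ Sum.inl) r (Fin.last k₁) - colSum (y ∘ Sum.inr) r 0) := by
  have swap (a : Fin (m + 1) → ZMod d) :
      ∑ r : Fin (m + 1), (∑ r' : Fin m with r.1 ≤ r'.1, s r') * a r =
        ∑ r' : Fin m, s r' * ∑ r : Fin (m + 1) with r.1 ≤ r'.1, a r := by
    simp only [Finset.sum_filter, Finset.sum_mul, Finset.mul_sum]
    rw [Finset.sum_comm]
    simp
  simp only [mul_sub, Finset.sum_sub_distrib, colSum, ← swap]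
  simp [Fintype.sum_sum_type, Fintype.sum_prod_type, sub_eq_add_neg]

/-! ### Configurations and rough cuts -/

theorem forall_fin_rows_iff {a b : ℕ} (P : Fin (a + b + 1 + 1) → Prop) :
    (∀ r, P r) ↔ (∀ r : Fin (a + 1), P ⟨r, by omega⟩) ∧
      ∀ r : Fin (b + 1), P ⟨a + 1 + r, by omega⟩ := by
  refine ⟨fun h => ⟨fun _ => h _, fun _ => h _⟩, fun ⟨h1, h2⟩ r => ?_⟩
  by_cases h : r.1 < a + 1
  · exact h1 ⟨r, h⟩
  · convert h2 ⟨r - (a + 1), by omega⟩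
    simp only
    omega

/-- Rows of vertical edges are split in two parts by a rough cut. -/
theorem sum_fin_rows {a b : ℕ} (f : Fin (a + b + 1 + 1) → ZMod d) :
    ∑ r, f r = ∑ r : Fin (a + 1), f ⟨r, by omega⟩ + ∑ r : Fin (b + 1), f ⟨a + 1 + r, by omega⟩ := by
  rw [← Equiv.sum_comp (finCongr (by omega : a + 1 + (b + 1) = a + b + 1 + 1)), Fin.sum_univ_add]
  rfl

/-- The total outcome `∑_{c' ≥ c} t c'` of the measured edges to the right of the column `c`. -/
def tailSum (t : Fin k → ZMod d) (c : Fin (k + 1)) : ZMod d := ∑ c' : Fin k with c.1 ≤ c'.1, t c'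

theorem tailSum_castSucc_sub_succ (t : Fin k → ZMod d) (c : Fin k) :
    tailSum t c.castSucc - tailSum t c.succ = t c := by
  have : (Finset.univ.filter fun c' : Fin k => c.castSucc.1 ≤ c'.1) =
      insert c (Finset.univ.filter fun c' : Fin k => c.succ.1 ≤ c'.1) := by
    ext c'; simp [Fin.ext_iff]; omega
  rw [tailSum, tailSum, this, Finset.sum_insert (by simp), add_sub_cancel_right]

/-- The part of the configuration `y` above the cut, shifted by the Pauli frame of the outcome
`t`. -/
def upperPart (t : Fin k → ZMod d) (y : Edge m₁ k ⊕ Edge m₂ k → ZMod d) : Edge m₁ k → ZMod d :=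
  y ∘ Sum.inl - Sum.elim (fun e => if e.1 = Fin.last m₁ then tailSum t e.2 else 0) fun _ => 0

/-- The part of the configuration `y` below the cut, shifted by the Pauli frame of the outcome
`t`. -/
def lowerPart (t : Fin k → ZMod d) (y : Edge m₁ k ⊕ Edge m₂ k → ZMod d) : Edge m₂ k → ZMod d :=
  y ∘ Sum.inr - Sum.elim (fun e => if e.1 = 0 then -tailSum t e.2 else 0) fun _ => 0

/-- The Pauli frame of a rough split makes up for the missing measured edges in the faces along the
cut. -/
theorem isFlat_roughCut_iff (t : Fin k → ZMod d) (y : Edge m₁ k ⊕ Edge m₂ k → ZMod d) :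
    IsFlat (Sum.elim t y ∘ (roughCut m₁ m₂ k).symm) ↔
      IsFlat (upperPart t y) ∧ IsFlat (lowerPart t y) := by
  set z := Sum.elim t y ∘ (roughCut m₁ m₂ k).symm with z_def
  have hz (e) : z (roughCut m₁ m₂ k e) = Sum.elim t y e := by simp [z_def]
  have vu (r : Fin (m₁ + 1)) (c : Fin (k + 1)) :
      z (vert ⟨r, by omega⟩ c) = y (Sum.inl (vert r c)) := hz (Sum.inr (Sum.inl (vert r c)))
  have vl (r : Fin (m₂ + 1)) (c : Fin (k + 1)) :
      z (vert ⟨m₁ + 1 + r, by omega⟩ c) = y (Sum.inr (vert r c)) :=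
    hz (Sum.inr (Sum.inr (vert r c)))
  have hu (r : Fin m₁) (c : Fin k) :
      z (horiz ⟨r, by omega⟩ c) = y (Sum.inl (horiz r c)) := hz (Sum.inr (Sum.inl (horiz r c)))
  have hl (r : Fin m₂) (c : Fin k) :
      z (horiz ⟨m₁ + 1 + r, by omega⟩ c) = y (Sum.inr (horiz r c)) :=
    hz (Sum.inr (Sum.inr (horiz r c)))
  have hm (c : Fin k) : z (horiz ⟨m₁, by omega⟩ c) = t c := hz (Sum.inl c)
  simp only [isFlat_iff_face]
  rw [← forall_and]
  refine forall_congr' fun c => ?_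
  rw [forall_fin_rows_iff]
  have ht := tailSum_castSucc_sub_succ t c
  refine and_congr (forall_congr' fun r => ?_) (forall_congr' fun r => ?_)
  · have above : rowAbove (fun r => z (horiz r c)) ⟨r, by omega⟩ =
        rowAbove (fun r => upperPart t y (horiz r c)) r := by
      unfold rowAbove
      split_ifs with h
      · rfl
      · have h0 : r.1 ≠ 0 := h
        simp only [upperPart, Pi.sub_apply, Sum.elim_inr, sub_zero]
        exact hu ⟨r.1 - 1, by omega⟩ c
    have below : rowBelow (fun r => z (horiz r c)) ⟨r, by omega⟩ =
        rowBelow (fun r => upperPart t y (horiz r c)) r + if r = Fin.last m₁ then t c else 0 := by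
      unfold rowBelow
      rw [dif_pos (by simp only; omega)]
      split_ifs with h h' h'
      · simp [h'] at h
      · simp only [upperPart, Pi.sub_apply, Sum.elim_inr, sub_zero, add_zero]
        exact hu ⟨r.1, h⟩ c
      · subst h'
        rw [zero_add]
        exact hm c
      · exact absurd (Fin.ext (by simp; omega)) h'
    rw [above, below, vu, vu, upperPart]
    simp only [Pi.sub_apply, Function.comp_apply, Sum.elim_inl]
    split_ifs
    · rw [← ht]
      constructor <;> intro h <;> linear_combination h
    · simp
  · have above : rowAbove (fun r => z (horiz r c)) ⟨m₁ + 1 + r, by omega⟩ =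
        rowAbove (fun r => lowerPart t y (horiz r c)) r + if r = 0 then t c else 0 := by
      unfold rowAbove
      rw [dif_neg (by simp only; omega)]
      split_ifs with h h' h'
      · subst h'
        rw [zero_add]
        exact hm c
      · exact absurd (Fin.ext h) h'
      · exact absurd (by rw [h']; rfl) h
      · simp only [lowerPart, Pi.sub_apply, Sum.elim_inr, sub_zero, add_zero]
        refine Eq.trans ?_ (hl ⟨r.1 - 1, by omega⟩ c)
        congr 3
        simp only
        omega
    have below : rowBelow (fun r => z (horiz r c)) ⟨m₁ + 1 + r, by omega⟩ =
        rowBelow (fun r => lowerPart t y (horiz r c)) r := by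
      unfold rowBelow
      by_cases h : r.1 < m₂
      · rw [dif_pos h, dif_pos (by simp only; omega)]
        simp only [lowerPart, Pi.sub_apply, Sum.elim_inr, sub_zero]
        exact hl ⟨r.1, h⟩ c
      · rw [dif_neg h, dif_neg (by simp only; omega)]
    rw [above, below, vl, vl, lowerPart]
    simp only [Pi.sub_apply, Function.comp_apply, Sum.elim_inl]
    split_ifs
    · rw [← ht]
      constructor <;> intro h <;> linear_combination h
    · simp

theorem hol_roughCut (t : Fin k → ZMod d) (y : Edge m₁ k ⊕ Edge m₂ k → ZMod d) :
    hol 0 (Sum.elim t y ∘ (roughCut m₁ m₂ k).symm) =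
      hol 0 (upperPart t y) + hol 0 (lowerPart t y) := by
  set z := Sum.elim t y ∘ (roughCut m₁ m₂ k).symm with z_def
  have hz (e) : z (roughCut m₁ m₂ k e) = Sum.elim t y e := by simp [z_def]
  have vu (r : Fin (m₁ + 1)) : z (vert ⟨r, by omega⟩ 0) = y (Sum.inl (vert r 0)) :=
    hz (Sum.inr (Sum.inl (vert r 0)))
  have vl (r : Fin (m₂ + 1)) : z (vert ⟨m₁ + 1 + r, by omega⟩ 0) = y (Sum.inr (vert r 0)) :=
    hz (Sum.inr (Sum.inr (vert r 0)))
  rw [hol, sum_fin_rows]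
  simp only [vu, vl]
  simp [hol, upperPart, lowerPart, Finset.sum_sub_distrib]

variable [NeZero d]

/-! ### Smooth splits -/

theorem conj_qpow (a : ZMod d) : conj (qpow a) = qpow (-a) := by
  rw [qpow, qpow, AddChar.map_neg_eq_conj]

theorem qpow_sum {ι : Type*} (s : Finset ι) (a : ι → ZMod d) :
    qpow (∑ i ∈ s, a i) = ∏ i ∈ s, qpow (a i) := by
  induction s using Finset.cons_induction with
  | empty => simp [qpow]
  | cons i s hi ih =>
    rw [Finset.sum_cons, Finset.prod_cons, ← ih, qpow, AddChar.map_add_eq_mul]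
    rfl

theorem prod_conj_ketDelta (s x : Fin m → ZMod d) :
    ∏ r, conj (ketDelta (s r) (x r)) = ((√(d : ℝ) : ℂ) ^ m)⁻¹ * qpow (∑ r, s r * x r) := by
  simp [ketDelta, conj_qpow, Finset.prod_mul_distrib, qpow_sum]

/-- Of all values on the cut edges, only those forced by flatness contribute to the amplitude after
the measurement, with the phase that makes up the Pauli frame. -/
theorem smoothSplit_holState_single (s : Fin m → ZMod d) (i : ZMod d) :
    smoothSplit d s (holState m (k₁ + k₂ + 1) (Pi.single i 1)) =
      ((√(d : ℝ) : ℂ) ^ m)⁻¹ • smoothFrame d s (fun y =>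
        holState m k₁ (Pi.single i 1) (y ∘ Sum.inl) *
          holState m k₂ (Pi.single i 1) (y ∘ Sum.inr)) := by
  funext y
  change ∑ x : Fin m → ZMod d, (∏ r, conj (ketDelta (s r) (x r))) *
      holState m (k₁ + k₂ + 1) (Pi.single i 1) (Sum.elim x y ∘ (smoothCut m k₁ k₂).symm) =
    _ * (qpow _ * _)
  rw [sum_smoothFrame_mul, ← mul_assoc, ← prod_conj_ketDelta, Finset.sum_eq_single
    (fun r => colSum (y ∘ Sum.inl) r (Fin.last k₁) - colSum (y ∘ Sum.inr) r 0)]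
  · congr 1
    have hol_zero (x : Fin m → ZMod d) :
        hol 0 (Sum.elim x y ∘ (smoothCut m k₁ k₂).symm) = hol 0 (y ∘ Sum.inl) := rfl
    simp only [holState, isFlat_smoothCut_iff, and_true, hol_zero]
    by_cases hl : IsFlat (y ∘ Sum.inl)
    · by_cases hr : IsFlat (y ∘ Sum.inr)
      · simp only [hl, hr, hl.hol_eq (Fin.last k₁), true_and, if_true, Pi.single_apply]
        have : (d : ℂ) ^ (m * (k₁ + k₂ + 1 + 1)) =
            (d : ℂ) ^ (m * (k₁ + 1)) * (d : ℂ) ^ (m * (k₂ + 1)) := by ring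
        rw [this, mul_inv]
        by_cases h : hol 0 (y ∘ Sum.inl) = hol 0 (y ∘ Sum.inr)
        · rw [if_pos h, h]
          split_ifs <;> ring
        · rw [if_neg h]
          split_ifs with h1 h2
          · exact absurd (h1.trans h2.symm) h
          all_goals ring
      · simp [hr]
    · simp [hl]
  · intro x _ hx
    simp [holState, isFlat_smoothCut_iff, hx]
  · simp

/-! ### Rough splits -/

theorem roughSplit_apply (t : Fin k → ZMod d) (ψ : Qudits d (Edge (m₁ + m₂ + 1) k))
    (y : Edge m₁ k ⊕ Edge m₂ k → ZMod d) :
    roughSplit d t ψ y = ψ (Sum.elim t y ∘ (roughCut m₁ m₂ k).symm) := by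
  change ∑ x : Fin k → ZMod d, (∏ c, conj (ketZ (t c) (x c))) *
    ψ (Sum.elim x y ∘ (roughCut m₁ m₂ k).symm) = _
  rw [Finset.sum_eq_single t]
  · simp [ketZ]
  · intro x _ hx
    obtain ⟨c, hc⟩ := Function.ne_iff.1 hx
    rw [Finset.prod_eq_zero (Finset.mem_univ c) (by simp [ketZ, hc]), zero_mul]
  · simp

/-- The holonomy of a column is the sum of its holonomies above and below the cut, so that the
indicator of the holonomy `i` becomes a convolution. -/
theorem roughSplit_holState_single (t : Fin k → ZMod d) (i : ZMod d) :
    roughSplit d t (holState (m₁ + m₂ + 1) k (Pi.single i 1)) =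
      ((d : ℂ) ^ (k + 1))⁻¹ • roughFrame d t (fun y => ∑ h : ZMod d,
        holState m₁ k (Pi.single h 1) (y ∘ Sum.inl) *
          holState m₂ k (Pi.single (i - h) 1) (y ∘ Sum.inr)) := by
  funext y
  rw [roughSplit_apply]
  change _ = _ * ∑ h : ZMod d, holState m₁ k (Pi.single h 1) (upperPart t y) *
    holState m₂ k (Pi.single (i - h) 1) (lowerPart t y)
  simp only [holState, isFlat_roughCut_iff, hol_roughCut]
  by_cases hu : IsFlat (upperPart t y)
  · by_cases hl : IsFlat (lowerPart t y)
    · simp only [hu, hl, true_and, if_true, Pi.single_apply]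
      have : (d : ℂ) ^ ((m₁ + m₂ + 1) * (k + 1)) = (d : ℂ) ^ (k + 1) *
          ((d : ℂ) ^ (m₁ * (k + 1)) * (d : ℂ) ^ (m₂ * (k + 1))) := by ring
      rw [this, mul_inv, mul_inv, mul_assoc, Finset.sum_eq_single (hol 0 (upperPart t y))]
      · simp only [if_true, eq_sub_iff_add_eq']
        ring
      · intro h _ hh
        rw [if_neg hh.symm]
        ring
      · simp
    · simp [hl]
  · simp [hu]

/-! ### Splits of logical states -/

theorem logicalPair_tmul (φ : vacuum d m₁ k₁) (χ : vacuum d m₂ k₂) :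
    logicalPair d m₁ k₁ m₂ k₂ (φ ⊗ₜ[ℂ] χ) = fun y =>
      (φ : Qudits d (Edge m₁ k₁)) (y ∘ Sum.inl) * (χ : Qudits d (Edge m₂ k₂)) (y ∘ Sum.inr) := by
  simp [logicalPair, glue]

/-- The smooth split of logical states, `|i⟩_L ↦ |i⟩_L ⊗ |i⟩_L`. -/
noncomputable def smoothSplitL (d : ℕ) [NeZero d] (m k₁ k₂ : ℕ) :
    vacuum d m (k₁ + k₂ + 1) →ₗ[ℂ] vacuum d m k₁ ⊗[ℂ] vacuum d m k₂ :=
  (logicalBasis d m (k₁ + k₂ + 1)).constr ℂ fun i =>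
    logicalBasis d m k₁ i ⊗ₜ[ℂ] logicalBasis d m k₂ i

/-- The rough split of logical states, `|i⟩_L ↦ ∑_h |h⟩_L ⊗ |i - h⟩_L`. -/
noncomputable def roughSplitL (d : ℕ) [NeZero d] (m₁ m₂ k : ℕ) :
    vacuum d (m₁ + m₂ + 1) k →ₗ[ℂ] vacuum d m₁ k ⊗[ℂ] vacuum d m₂ k :=
  (logicalBasis d (m₁ + m₂ + 1) k).constr ℂ fun i =>
    ∑ h : ZMod d, logicalBasis d m₁ k h ⊗ₜ[ℂ] logicalBasis d m₂ k (i - h)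

theorem smoothSplitL_logicalBasis (i : ZMod d) :
    smoothSplitL d m k₁ k₂ (logicalBasis d m (k₁ + k₂ + 1) i) =
      logicalBasis d m k₁ i ⊗ₜ[ℂ] logicalBasis d m k₂ i :=
  Module.Basis.constr_basis _ _ _ _

theorem roughSplitL_logicalBasis (i : ZMod d) :
    roughSplitL d m₁ m₂ k (logicalBasis d (m₁ + m₂ + 1) k i) =
      ∑ h : ZMod d, logicalBasis d m₁ k h ⊗ₜ[ℂ] logicalBasis d m₂ k (i - h) :=
  Module.Basis.constr_basis _ _ _ _

/-- The rough split is the convolution coproduct, which the Fourier transform turns into the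
diagonal one. -/
theorem roughSplitL_logicalFourierBasis (i : ZMod d) :
    roughSplitL d m₁ m₂ k (logicalFourierBasis d (m₁ + m₂ + 1) k i) =
      logicalFourierBasis d m₁ k i ⊗ₜ[ℂ] logicalFourierBasis d m₂ k i := by
  simp only [logicalFourierBasis_eq_sum, map_sum, map_smul, roughSplitL_logicalBasis,
    TensorProduct.sum_tmul, TensorProduct.tmul_sum, Finset.smul_sum]
  rw [Finset.sum_comm]
  conv_rhs => rw [Finset.sum_comm]
  refine Finset.sum_congr rfl fun h _ => ?_
  rw [← Equiv.sum_comp (Equiv.addLeft h)]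
  refine Finset.sum_congr rfl fun l _ => ?_
  rw [TensorProduct.smul_tmul_smul, Equiv.coe_addLeft, add_sub_cancel_left, mul_add, neg_add,
    qpow, qpow, qpow, AddChar.map_add_eq_mul]

theorem smoothSplit_vacuum (s : Fin m → ZMod d) (ψ : vacuum d m (k₁ + k₂ + 1)) :
    smoothSplit d s (ψ : Qudits d (Edge m (k₁ + k₂ + 1))) =
      ((√(d : ℝ) : ℂ) ^ m)⁻¹ •
        smoothFrame d s (logicalPair d m k₁ m k₂ (smoothSplitL d m k₁ k₂ ψ)) := by
  have : smoothSplit d s ∘ₗ (vacuum d m (k₁ + k₂ + 1)).subtype = ((√(d : ℝ) : ℂ) ^ m)⁻¹ •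
      (smoothFrame d s ∘ₗ logicalPair d m k₁ m k₂ ∘ₗ smoothSplitL d m k₁ k₂) := by
    refine (logicalBasis d m (k₁ + k₂ + 1)).ext fun i => ?_
    simp only [LinearMap.comp_apply, LinearMap.smul_apply, Submodule.subtype_apply,
      smoothSplitL_logicalBasis, logicalPair_tmul, coe_logicalBasis]
    exact smoothSplit_holState_single s i
  exact LinearMap.congr_fun this ψ

theorem roughSplit_vacuum (t : Fin k → ZMod d) (ψ : vacuum d (m₁ + m₂ + 1) k) :
    roughSplit d t (ψ : Qudits d (Edge (m₁ + m₂ + 1) k)) =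
      ((d : ℂ) ^ (k + 1))⁻¹ •
        roughFrame d t (logicalPair d m₁ k m₂ k (roughSplitL d m₁ m₂ k ψ)) := by
  have : roughSplit d t ∘ₗ (vacuum d (m₁ + m₂ + 1) k).subtype = ((d : ℂ) ^ (k + 1))⁻¹ •
      (roughFrame d t ∘ₗ logicalPair d m₁ k m₂ k ∘ₗ roughSplitL d m₁ m₂ k) := by
    refine (logicalBasis d (m₁ + m₂ + 1) k).ext fun i => ?_
    simp only [LinearMap.comp_apply, LinearMap.smul_apply, Submodule.subtype_apply,
      roughSplitL_logicalBasis, map_sum, logicalPair_tmul, coe_logicalBasis]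
    rw [roughSplit_holState_single, ← map_sum]
    congr 2
    funext y
    rw [Finset.sum_apply]
  exact LinearMap.congr_fun this ψ

end Splits

end QuditSurface

theorem mainTheorem3 (d : ℕ) [NeZero d] (hd : 2 ≤ d) :
    ∃ b β : ∀ m k : ℕ, Module.Basis (ZMod d) ℂ (vacuum d m k),
      -- the two bases `|i⟩_L` and `|δ_i⟩_L` of the logical space of every patch
      (∀ m k (r : Fin (m + 1)) (i : ZMod d), (b m k i : Qudits d (Edge m k)) = ketL d r i) ∧
      (∀ m k (c : Fin (k + 1)) (i : ZMod d), (β m k i : Qudits d (Edge m k)) = ketDeltaL d c i) ∧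
      (∀ m k (i : ZMod d), β m k i = ∑ j : ZMod d, qpow (-(i * j)) • b m k j) ∧
      -- smooth splits
      (∀ m k₁ k₂ : ℕ,
        ∃ Δ : vacuum d m (k₁ + k₂ + 1) →ₗ[ℂ] vacuum d m k₁ ⊗[ℂ] vacuum d m k₂,
          (∀ i : ZMod d, Δ (b m (k₁ + k₂ + 1) i) = b m k₁ i ⊗ₜ[ℂ] b m k₂ i) ∧
          ∀ (s : Fin m → ZMod d) (ψ : vacuum d m (k₁ + k₂ + 1)),
            smoothSplit d s (ψ : Qudits d (Edge m (k₁ + k₂ + 1))) =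
              ((√(d : ℝ) : ℂ) ^ m)⁻¹ • smoothFrame d s (logicalPair d m k₁ m k₂ (Δ ψ))) ∧
      -- rough splits
      (∀ m₁ m₂ k : ℕ,
        ∃ Δ : vacuum d (m₁ + m₂ + 1) k →ₗ[ℂ] vacuum d m₁ k ⊗[ℂ] vacuum d m₂ k,
          (∀ i : ZMod d, Δ (β (m₁ + m₂ + 1) k i) = β m₁ k i ⊗ₜ[ℂ] β m₂ k i) ∧
          (∀ i : ZMod d,
            Δ (b (m₁ + m₂ + 1) k i) = ∑ h : ZMod d, b m₁ k h ⊗ₜ[ℂ] b m₂ k (i - h)) ∧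
          ∀ (t : Fin k → ZMod d) (ψ : vacuum d (m₁ + m₂ + 1) k),
            roughSplit d t (ψ : Qudits d (Edge (m₁ + m₂ + 1) k)) =
              ((d : ℂ) ^ (k + 1))⁻¹ • roughFrame d t (logicalPair d m₁ k m₂ k (Δ ψ))) :=
  ⟨logicalBasis d, logicalFourierBasis d,
    fun _ _ r i => (coe_logicalBasis i).trans (ketL_eq r i).symm,
    fun _ _ c i => (coe_logicalFourierBasis i).trans (ketDeltaL_eq c i).symm,
    fun _ _ i => logicalFourierBasis_eq_sum i,
    fun m k₁ k₂ => ⟨smoothSplitL d m k₁ k₂, smoothSplitL_logicalBasis, smoothSplit_vacuum⟩,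
    fun m₁ m₂ k => ⟨roughSplitL d m₁ m₂ k, roughSplitL_logicalFourierBasis,
      roughSplitL_logicalBasis, roughSplit_vacuum⟩⟩
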